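/- Let $p$ be a prime, $K=\mathbb{F}_p(t)$, and let $\phi\colon\mathbb{P}^1\to\mathbb{P}^1$ be an endomorphism of degree $d\ge 2$ defined over $K$, given by $\phi([X:Y])=[F(X,Y):G(X,Y)]$ with $F,G\in K[X,Y]$ coprime homogeneous polynomials of degree $d$. Suppose that $\phi$ has good reduction at every finite place of $K$. That is, for every nonzero prime ideal $\mathfrak p$ of $\mathbb{F}_p[t]$, with local ring $R_{\mathfrak p}\subset K$ and residue field $k(\mathfrak p)$, if $F,G$ are multiplied by a constant in $K^*$ so that all their coefficients lie in $R_{\mathfrak p}$ and at least one is a unit of $R_{\mathfrak p}$, then the rational map over $k(\mathfrak p)$ obtained by reducing the coefficients modulo $\mathfrak p$ again has degree $d$. Let $P\in\mathbb{P}^1(K)$. If $P$ is periodic for $\phi$ with minimal period $n$ (the least $n\ge 1$ with $\phi^n(P)=P$), then - $n\le 3$ if $p=2$; - $n\le 72$ if $p=3$; - $n\le (p^2-1)p$ if $p\ge 5$. More generally, if $P$ is preperiodic for $\phi$, i.e. its forward orbit $O_\phi(P)=\{\phi^n(P)\mid n\ge 0\}$ contains a periodic point, then - $|O_\phi(P)|\le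 9$ if $p=2$; - $|O_\phi(P)|\le 288$ if $p=3$; - $|O_\phi(P)|\le (p+1)(p^2-1)p$ if $p\ge 5$. -/

import Mathlib

/-- The set `ℙ¹(K)` of `K`-rational points of the projective line. -/
abbrev ProjLine (K : Type*) [Field K] : Type _ := Projectivization K (Fin 2 → K)

/-- An endomorphism of `ℙ¹` defined over `K`, written `[X : Y] ↦ [F(X, Y) : G(X, Y)]` with
`F, G ∈ K[X, Y]` coprime homogeneous polynomials of the same degree, the degree of the map. -/
structure ProjLineEndo (K : Type*) [Field K] where
  /-- the degree of the endomorphism -/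
  degree : ℕ
  /-- the first homogeneous coordinate -/
  F : MvPolynomial (Fin 2) K
  /-- the second homogeneous coordinate -/
  G : MvPolynomial (Fin 2) K
  homogeneous_F : F.IsHomogeneous degree
  homogeneous_G : G.IsHomogeneous degree
  coprime : IsRelPrime F G

namespace ProjLineEndo

theorem aeval_smul_of_isHomogeneous {K A : Type*} [Field K] [CommRing A] [Algebra K A] {d : ℕ}
    {F : MvPolynomial (Fin 2) K} (hF : F.IsHomogeneous d) (s : A) (v : Fin 2 → A) :
    MvPolynomial.aeval (s • v) F = s ^ d * MvPolynomial.aeval v F := by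
  rw [MvPolynomial.aeval_def, MvPolynomial.aeval_def, MvPolynomial.eval₂_eq',
    MvPolynomial.eval₂_eq', Finset.mul_sum]
  refine Finset.sum_congr rfl fun m hm => ?_
  have hd : m 0 + m 1 = d := by
    have := hF (MvPolynomial.mem_support_iff.1 hm)
    rw [Finsupp.weight_apply, Finsupp.sum_fintype _ _ (by simp)] at this
    simpa using this
  simp only [Fin.prod_univ_two, Pi.smul_apply, smul_eq_mul, mul_pow, ← hd, pow_add]
  ring

theorem eval_smul_of_isHomogeneous {K : Type*} [Field K] {d : ℕ}
    {F : MvPolynomial (Fin 2) K} (hF : F.IsHomogeneous d) (s : K) (v : Fin 2 → K) :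
    MvPolynomial.eval (s • v) F = s ^ d * MvPolynomial.eval v F := by
  simpa [MvPolynomial.aeval_eq_eval] using aeval_smul_of_isHomogeneous hF s v

/-- A binary form vanishing at `v ≠ 0` is divisible by the linear form of `v`. -/
theorem linearForm_dvd {K : Type*} [Field K] {d : ℕ} {F : MvPolynomial (Fin 2) K}
    (hF : F.IsHomogeneous d) {v : Fin 2 → K} (hv : v ≠ 0) (h : MvPolynomial.eval v F = 0) :
    (MvPolynomial.C (v 1) * MvPolynomial.X 0 - MvPolynomial.C (v 0) * MvPolynomial.X 1 :
      MvPolynomial (Fin 2) K) ∣ F := by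
  set L : MvPolynomial (Fin 2) K :=
    MvPolynomial.C (v 1) * MvPolynomial.X 0 - MvPolynomial.C (v 0) * MvPolynomial.X 1 with hL
  let I : Ideal (MvPolynomial (Fin 2) K) := Ideal.span {L}
  let q : MvPolynomial (Fin 2) K →ₐ[K] (MvPolynomial (Fin 2) K ⧸ I) := Ideal.Quotient.mkₐ K I
  have hLq : algebraMap K _ (v 1) * q (MvPolynomial.X 0)
      = algebraMap K _ (v 0) * q (MvPolynomial.X 1) := by
    have h0 : q L = 0 :=
      Ideal.Quotient.eq_zero_iff_mem.2 (Ideal.mem_span_singleton_self L)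
    have hC : ∀ a : K, q (MvPolynomial.C a) = algebraMap K _ a := fun a => q.commutes a
    rw [hL, map_sub, map_mul, map_mul, hC, hC] at h0
    exact sub_eq_zero.1 h0
  have hinv : ∀ a : K, a ≠ 0 →
      algebraMap K (MvPolynomial (Fin 2) K ⧸ I) a⁻¹ * algebraMap K _ a = 1 := fun a ha => by
    rw [← map_mul, inv_mul_cancel₀ ha, map_one]
  have hq : ∃ s : MvPolynomial (Fin 2) K ⧸ I,
      (fun i => q (MvPolynomial.X i)) = s • fun i => algebraMap K _ (v i) := by
    by_cases h1 : v 1 = 0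
    · have h0 : v 0 ≠ 0 := by
        intro h0
        exact hv (by ext i; fin_cases i <;> simp [h0, h1])
      refine ⟨algebraMap K _ (v 0)⁻¹ * q (MvPolynomial.X 0), ?_⟩
      ext i
      fin_cases i
      · simp only [Pi.smul_apply, smul_eq_mul, Fin.zero_eta]
        linear_combination -(q (MvPolynomial.X 0)) * hinv _ h0
      · simp only [Pi.smul_apply, smul_eq_mul, Fin.mk_one]
        linear_combination -(q (MvPolynomial.X 1)) * hinv _ h0
          - algebraMap K _ (v 0)⁻¹ * hLq
    · refine ⟨algebraMap K _ (v 1)⁻¹ * q (MvPolynomial.X 1), ?_⟩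
      ext i
      fin_cases i
      · simp only [Pi.smul_apply, smul_eq_mul, Fin.zero_eta]
        linear_combination -(q (MvPolynomial.X 0)) * hinv _ h1
          + algebraMap K _ (v 1)⁻¹ * hLq
      · simp only [Pi.smul_apply, smul_eq_mul, Fin.mk_one]
        linear_combination -(q (MvPolynomial.X 1)) * hinv _ h1
  obtain ⟨s, hs⟩ := hq
  have hqF : q F = MvPolynomial.aeval (fun i => q (MvPolynomial.X i)) F := by
    rw [← MvPolynomial.comp_aeval_apply, MvPolynomial.aeval_X_left_apply]
  have hz : q F = 0 := by
    rw [hqF, hs, aeval_smul_of_isHomogeneous hF]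
    have : MvPolynomial.aeval (fun i => algebraMap K (MvPolynomial (Fin 2) K ⧸ I) (v i)) F
        = algebraMap K _ (MvPolynomial.eval v F) := by
      exact MvPolynomial.aeval_algebraMap_apply _ v F
    rw [this, h, map_zero, mul_zero]
  exact Ideal.mem_span_singleton.1 (Ideal.Quotient.eq_zero_iff_mem.1 hz)

variable {K : Type*} [Field K]

/-- The two coordinates of an endomorphism have no common zero. -/
theorem eval_ne_zero (Φ : ProjLineEndo K) {v : Fin 2 → K} (hv : v ≠ 0) :
    ![MvPolynomial.eval v Φ.F, MvPolynomial.eval v Φ.G] ≠ 0 := by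
  intro h
  have hF : MvPolynomial.eval v Φ.F = 0 := by simpa using congrFun h 0
  have hG : MvPolynomial.eval v Φ.G = 0 := by simpa using congrFun h 1
  have hu := Φ.coprime (linearForm_dvd Φ.homogeneous_F hv hF)
    (linearForm_dvd Φ.homogeneous_G hv hG)
  have := hu.map (MvPolynomial.eval v)
  simp [mul_comm] at this

/-- The action of an endomorphism on points, `[x : y] ↦ [F(x, y) : G(x, y)]`. -/
noncomputable def onPoints (Φ : ProjLineEndo K) : ProjLine K → ProjLine K :=
  Projectivization.lift
    (fun v : {v : Fin 2 → K // v ≠ 0} =>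
      Projectivization.mk K ![MvPolynomial.eval v.1 Φ.F, MvPolynomial.eval v.1 Φ.G]
        (Φ.eval_ne_zero v.2))
    (by
      rintro ⟨a, ha⟩ ⟨b, hb⟩ t (h : a = t • b)
      rw [Projectivization.mk_eq_mk_iff']
      refine ⟨t ^ Φ.degree, ?_⟩
      subst h
      ext i
      fin_cases i <;>
        simp [eval_smul_of_isHomogeneous Φ.homogeneous_F,
          eval_smul_of_isHomogeneous Φ.homogeneous_G])

/-- The rational map `[F : G]` over a field `k` has degree `e`: after removing a common factor
`H ≠ 0` it is given by coprime homogeneous polynomials of degree `e`. -/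
def RatMapHasDegree {k : Type*} [Field k] (F G : MvPolynomial (Fin 2) k) (e : ℕ) : Prop :=
  ∃ H F' G' : MvPolynomial (Fin 2) k, H ≠ 0 ∧ F = H * F' ∧ G = H * G' ∧
    F'.IsHomogeneous e ∧ G'.IsHomogeneous e ∧ IsRelPrime F' G'

/-- `[F₀ : G₀]` is a reduced form of `Φ` with respect to the local ring `R ⊆ K`: it is obtained
from `Φ` by scaling by a nonzero constant, the coefficients are in `R`, and at least one of them
is a unit of `R`. -/
def IsReducedForm (Φ : ProjLineEndo K) (R : ValuationSubring K)
    (F₀ G₀ : MvPolynomial (Fin 2) R) : Prop :=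
  (∃ c : K, c ≠ 0 ∧ MvPolynomial.map (algebraMap R K) F₀ = MvPolynomial.C c * Φ.F ∧
    MvPolynomial.map (algebraMap R K) G₀ = MvPolynomial.C c * Φ.G) ∧
  ∃ m, IsUnit (F₀.coeff m) ∨ IsUnit (G₀.coeff m)

/-- `Φ` has good reduction at the place with local ring `R`: the map over the residue field
obtained by reducing the coefficients of a reduced form has the same degree as `Φ`.
(Any two reduced forms differ by a unit of `R`, so the choice does not matter.) -/
def HasGoodReduction (Φ : ProjLineEndo K) (R : ValuationSubring K) : Prop :=
  ∃ F₀ G₀ : MvPolynomial (Fin 2) R, Φ.IsReducedForm R F₀ G₀ ∧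
    RatMapHasDegree (MvPolynomial.map (IsLocalRing.residue R) F₀)
      (MvPolynomial.map (IsLocalRing.residue R) G₀) Φ.degree

/-- The forward orbit `{φⁿ(P) | n ≥ 0}`. -/
def orbit (Φ : ProjLineEndo K) (P : ProjLine K) : Set (ProjLine K) :=
  Set.range fun n : ℕ => Φ.onPoints^[n] P

/-- `P` is preperiodic if its forward orbit contains a periodic point. -/
def IsPreperiodic (Φ : ProjLineEndo K) (P : ProjLine K) : Prop :=
  ∃ Q ∈ Φ.orbit P, Q ∈ Function.periodicPts Φ.onPoints

end ProjLineEndo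

/-- The local ring of `𝔽_p(t)` at a finite place, i.e. at a nonzero prime ideal of `𝔽_p[t]`. -/
noncomputable def finitePlaceRing (p : ℕ) [Fact p.Prime]
    (v : IsDedekindDomain.HeightOneSpectrum (Polynomial (ZMod p))) :
    ValuationSubring (RatFunc (ZMod p)) :=
  (v.valuation (RatFunc (ZMod p))).valuationSubring

/-!
The proof uses only distances at the finite places. For a valuation ring `R` of `K` with residue
field `k`, every point of the projective line has normalized coordinates `(x, 1)` or `(1, y)`
over `R`, and the separation `sep R P Q` is the determinant of the normalized coordinates of
`P` and `Q`; its divisors in `R` measure how close the points are, and the ultrametric inequality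
is `dvd_sep_trans`. A map with good reduction is residually differentiable
(`ProjLineEndo.HasGoodReduction.isResiduallyDifferentiable`): on each residue class it scales
separations by elements of `R` with a fixed residue, the multiplier. This is stable under composition, and it
implies that `sep R P Q` divides the separation of the images.

*Multipliers.* At the place `t = 0` the residue field is `𝔽_p`, so the reduction of a cycle has
some period `m ≤ p + 1`. The `m`-th iterate permutes cyclically points of one residue class, and
adding up the separations of consecutive points shows that a geometric sum in the multiplier
vanishes (`HasMultiplier.geom_sum_eq_zero`). Hence the period of that cycle is `r` or `r * p` with
`r ∣ p - 1`, or is divisible by `p ^ 2` (`IsResiduallyDifferentiable.period_of_red_eq`).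

*Cross-ratios.* An element of `𝔽_p(t)` that is a unit at all finite places lies in `𝔽_pˣ`. So for
given `P`, `Q` there are at most `p - 1` points `S` such that the cross-ratios of `P`, `Q` with any
two of them are units at all finite places (`card_lt_of_associated_sep`). Along a cycle the
separations are invariant under translation of the indices; for `p ≥ 3` this produces `p` such points from a
cycle of length `p ^ 2`, and for `p = 2` two such points from a cycle of length `4` or `6`. This
bounds the periods by `(p + 1) * ((p - 1) * p)`, and by `3` if `p = 2`.

*Tails.* Along a path into a fixed point the separation of two points depends only on the earlier
one, up to units, and the cross-ratio bound shows that such a path has at most `p` steps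
(`isFixedPt_of_isFixedPt_succ`). Applied to the iterate that fixes a cycle of length `n`, this
bounds the tail of a preperiodic orbit by `p * n`, and the orbit by `(p + 1) * n`.
-/

open IsLocalRing

namespace ProjLine

variable {K : Type*} [Field K] (R : ValuationSubring K)

/-! ### Normalized coordinates and the separation of points over a valuation ring -/

theorem exists_normalized (P : ProjLine K) :
    ∃ w : Fin 2 → R, (w 1 = 1 ∨ (w 0 = 1 ∧ residue R (w 1) = 0)) ∧
      ∃ h : (fun i => (w i : K)) ≠ 0, Projectivization.mk K (fun i => (w i : K)) h = P := by
  induction P using Projectivization.ind with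
  | h v hv =>
    by_cases h1 : v 1 ≠ 0 ∧ v 0 / v 1 ∈ R
    · have hw : (fun i => ((![⟨v 0 / v 1, h1.2⟩, 1] : Fin 2 → R) i : K)) ≠ 0 := by
        intro h
        simpa using congrFun h 1
      refine ⟨![⟨v 0 / v 1, h1.2⟩, 1], Or.inl rfl, hw, ?_⟩
      rw [Projectivization.mk_eq_mk_iff']
      refine ⟨(v 1)⁻¹, ?_⟩
      ext i
      fin_cases i
      · simp [div_eq_inv_mul]
      · simp [h1.1]
    · have h0 : v 0 ≠ 0 := by
        intro h0
        by_cases h : v 1 = 0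
        · exact hv (by ext i; fin_cases i <;> simp [h0, h])
        · exact h1 ⟨h, by simp [h0]⟩
      have hmem : v 1 / v 0 ∈ R := by
        by_cases h : v 1 = 0
        · simp [h]
        · rcases R.mem_or_inv_mem (v 1 / v 0) with h' | h'
          · exact h'
          · rw [inv_div] at h'
            exact absurd ⟨h, h'⟩ h1
      have hw : (fun i => ((![1, ⟨v 1 / v 0, hmem⟩] : Fin 2 → R) i : K)) ≠ 0 := by
        intro h
        simpa using congrFun h 0
      refine ⟨![1, ⟨v 1 / v 0, hmem⟩], Or.inr ⟨rfl, ?_⟩, hw, ?_⟩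
      · rw [residue_eq_zero_iff, mem_maximalIdeal, mem_nonunits_iff]
        rintro hu
        obtain ⟨b, hb⟩ := hu.exists_right_inv
        have hb' : v 1 / v 0 * (b : K) = 1 := by simpa using congrArg Subtype.val hb
        have hv1 : v 1 ≠ 0 := by
          rintro h
          simp [h] at hb'
        refine h1 ⟨hv1, ?_⟩
        have : (b : K) = v 0 / v 1 := by
          field_simp at hb' ⊢
          linear_combination hb'
        exact this ▸ b.2
      · rw [Projectivization.mk_eq_mk_iff']
        refine ⟨(v 0)⁻¹, ?_⟩
        ext i
        fin_cases i
        · simp [h0]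
        · simp [div_eq_inv_mul]

/-- The normalized coordinates of a point over a valuation ring `R`: they are `(x, 1)` with
`x ∈ R`, or `(1, y)` with `y` in the maximal ideal of `R`. -/
noncomputable def normRep (P : ProjLine K) : Fin 2 → R := (exists_normalized R P).choose

theorem normRep_cases (P : ProjLine K) :
    normRep R P 1 = 1 ∨ (normRep R P 0 = 1 ∧ residue R (normRep R P 1) = 0) :=
  (exists_normalized R P).choose_spec.1

theorem normRep_ne_zero (P : ProjLine K) : (fun i => (normRep R P i : K)) ≠ 0 :=
  (exists_normalized R P).choose_spec.2.choose

theorem mk_normRep (P : ProjLine K) :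
    Projectivization.mk K (fun i => (normRep R P i : K)) (normRep_ne_zero R P) = P :=
  (exists_normalized R P).choose_spec.2.choose_spec

/-- The reduction of a point modulo the maximal ideal of `R`, in normalized coordinates
`(x, 1)` or `(1, 0)`. -/
noncomputable def red (P : ProjLine K) : Fin 2 → ResidueField R :=
  fun i => residue R (normRep R P i)

theorem red_cases (P : ProjLine K) : red R P 1 = 1 ∨ red R P = ![1, 0] := by
  rcases normRep_cases R P with h | ⟨h, h'⟩
  · left
    simp [red, h]
  · right
    ext i
    fin_cases i <;> simp [red, h, h']

theorem red_ne_zero (P : ProjLine K) : red R P ≠ 0 := by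
  intro h
  rcases red_cases R P with h1 | h1
  · simp [h] at h1
  · have := congrFun (h1.symm.trans h) 0
    simp at this

open Classical in
/-- The factor by which nonzero coordinates `(x, y)` over a field differ from the normalized
coordinates `(x / y, 1)` or `(1, 0)`. -/
noncomputable def scale {k : Type*} [Field k] (c : Fin 2 → k) : k :=
  if c 1 = 0 then c 0 else c 1

theorem scale_ne_zero {k : Type*} [Field k] {c : Fin 2 → k} (hc : c ≠ 0) : scale c ≠ 0 := by
  unfold scale
  split_ifs with h
  · intro h0
    exact hc (by ext i; fin_cases i <;> simp [h0, h])
  · exact h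

/-- Coordinates over `R` that do not both vanish in the residue field are a unit multiple of the
normalized ones, and the residue of that unit is determined by the reduced coordinates. -/
theorem exists_eq_smul_normRep {w : Fin 2 → R} {P : ProjLine K}
    (hw : (fun i => residue R (w i)) ≠ 0) (hw0 : (fun i => (w i : K)) ≠ 0)
    (hP : Projectivization.mk K (fun i => (w i : K)) hw0 = P) :
    ∃ u : R, (∀ i, w i = u * normRep R P i) ∧
      residue R u = scale (fun i => residue R (w i)) := by
  have hmk := hP.trans (mk_normRep R P).symm
  rw [Projectivization.mk_eq_mk_iff'] at hmk
  obtain ⟨a, ha⟩ := hmk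
  have ha' : ∀ i, a * (normRep R P i : K) = w i := fun i => congrFun ha i
  rcases normRep_cases R P with h | ⟨h, h'⟩
  · have h1 : a = w 1 := by simpa [h] using ha' 1
    have hall : ∀ i, w i = w 1 * normRep R P i := fun i => by
      ext
      simpa [h1] using (ha' i).symm
    refine ⟨w 1, hall, ?_⟩
    unfold scale
    rw [if_neg]
    intro h0
    beta_reduce at h0
    apply hw
    ext i
    rw [hall i, map_mul, h0, zero_mul, Pi.zero_apply]
  · have h1 : a = w 0 := by simpa [h] using ha' 0
    have hall : ∀ i, w i = w 0 * normRep R P i := fun i => by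
      ext
      simpa [h1] using (ha' i).symm
    refine ⟨w 0, hall, ?_⟩
    unfold scale
    rw [if_pos]
    beta_reduce
    rw [hall 1, map_mul, h', mul_zero]

/-- The `R`-adic separation of two points: the determinant of their normalized coordinates.
Only its class up to units matters for distances; the precise value is used for multipliers. -/
noncomputable def sep (P Q : ProjLine K) : R :=
  normRep R P 0 * normRep R Q 1 - normRep R P 1 * normRep R Q 0

theorem sep_self (P : ProjLine K) : sep R P P = 0 := by
  unfold sep
  ring

theorem sep_comm (P Q : ProjLine K) : sep R P Q = -sep R Q P := by
  unfold sep
  ring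

theorem residue_sep (P Q : ProjLine K) :
    residue R (sep R P Q) = red R P 0 * red R Q 1 - red R P 1 * red R Q 0 := by
  simp [sep, red]

theorem red_eq_iff {P Q : ProjLine K} : red R P = red R Q ↔ residue R (sep R P Q) = 0 := by
  rw [residue_sep]
  constructor
  · intro h
    rw [h]
    ring
  · intro h
    rcases red_cases R P with hP | hP <;> rcases red_cases R Q with hQ | hQ
    · rw [hP, hQ, mul_one, one_mul, sub_eq_zero] at h
      ext i
      fin_cases i
      · exact h
      · exact hP.trans hQ.symm
    · rw [hP, hQ] at h
      simp at h
    · rw [hP, hQ] at h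
      simp at h
    · rw [hP, hQ]

theorem isUnit_sep {P Q : ProjLine K} (h : red R P ≠ red R Q) : IsUnit (sep R P Q) := by
  rw [Ne, red_eq_iff, residue_eq_zero_iff, mem_maximalIdeal, mem_nonunits_iff, not_not] at h
  exact h

theorem sep_eq_zero_iff {P Q : ProjLine K} : sep R P Q = 0 ↔ P = Q := by
  constructor
  · intro h
    have h' : (normRep R P 0 : K) * normRep R Q 1 = normRep R P 1 * normRep R Q 0 := by
      have := congrArg (Subtype.val) h
      simpa [sep, sub_eq_zero] using this
    rw [← mk_normRep R P, ← mk_normRep R Q, Projectivization.mk_eq_mk_iff']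
    have hred : red R P = red R Q := by rw [red_eq_iff, h, map_zero]
    rcases normRep_cases R P with hP | ⟨hP, hP'⟩ <;> rcases normRep_cases R Q with hQ | ⟨hQ, hQ'⟩
    · refine ⟨1, ?_⟩
      ext i
      fin_cases i
      · simpa [hP, hQ] using h'.symm
      · simp [hP, hQ]
    · have := congrFun hred 1
      simp [red, hP, hQ'] at this
    · have := congrFun hred 1
      simp [red, hQ, hP'] at this
    · refine ⟨1, ?_⟩
      ext i
      fin_cases i
      · simp [hP, hQ]
      · simpa [hP, hQ] using h'
  · rintro rfl
    exact sep_self R P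

/-- The ultrametric inequality for the separation. -/
theorem dvd_sep_trans {a : R} {P Q S : ProjLine K} (h : a ∣ sep R P Q) (h' : a ∣ sep R Q S) :
    a ∣ sep R P S := by
  have key : ∀ i, normRep R Q i * sep R P S
      = normRep R S i * sep R P Q + normRep R P i * sep R Q S := by
    intro i
    fin_cases i <;> simp only [sep, Fin.zero_eta, Fin.mk_one] <;> ring
  have hi : ∀ i, a ∣ normRep R Q i * sep R P S := fun i => by
    rw [key i]
    exact dvd_add (h.mul_left _) (h'.mul_left _)
  rcases normRep_cases R Q with hQ | ⟨hQ, -⟩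
  · simpa [hQ] using hi 1
  · simpa [hQ] using hi 0

/-- On points with the same reduction the separation is a difference of affine coordinates,
hence additive. -/
theorem sep_add {P Q S : ProjLine K} (h : red R P = red R Q) (h' : red R Q = red R S) :
    sep R P Q + sep R Q S = sep R P S := by
  have h1 := congrFun h 1
  have h1' := congrFun h' 1
  simp only [red] at h1 h1'
  rcases normRep_cases R P with hP | ⟨hP, hP'⟩ <;>
    rcases normRep_cases R Q with hQ | ⟨hQ, hQ'⟩ <;>
    rcases normRep_cases R S with hS | ⟨hS, hS'⟩ <;>
    simp_all [sep]

end ProjLine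

namespace ProjLine

/-! ### Multipliers on residue classes -/

variable {K : Type*} [Field K] (R : ValuationSubring K)

/-- `f` acts on the residue class `c` with multiplier `l`: it scales the separation of any two
points of `c` by an element of `R` with residue `l`. For a rational map with good reduction, `l`
is the derivative of the reduced map at `c` in the normalized affine coordinates. -/
def HasMultiplier (f : ProjLine K → ProjLine K) (c : Fin 2 → ResidueField R)
    (l : ResidueField R) : Prop :=
  ∀ P Q, red R P = c → red R Q = c →
    ∃ r : R, residue R r = l ∧ sep R (f P) (f Q) = r * sep R P Q

/-- `f` has a multiplier on each residue class. -/
def IsResiduallyDifferentiable (f : ProjLine K → ProjLine K) : Prop :=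
  ∀ c, ∃ l, HasMultiplier R f c l

variable {R} {f g : ProjLine K → ProjLine K}

theorem IsResiduallyDifferentiable.sep_dvd (hf : IsResiduallyDifferentiable R f)
    (P Q : ProjLine K) : sep R P Q ∣ sep R (f P) (f Q) := by
  by_cases h : red R P = red R Q
  · obtain ⟨l, hl⟩ := hf (red R Q)
    obtain ⟨r, -, hr⟩ := hl P Q h rfl
    exact ⟨r, hr.trans (mul_comm _ _)⟩
  · exact (isUnit_sep R h).dvd

theorem IsResiduallyDifferentiable.red_congr (hf : IsResiduallyDifferentiable R f)
    {P Q : ProjLine K} (h : red R P = red R Q) : red R (f P) = red R (f Q) := by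
  rw [red_eq_iff] at h ⊢
  obtain ⟨r, hr⟩ := hf.sep_dvd P Q
  rw [hr, map_mul, h, zero_mul]

theorem HasMultiplier.comp {c c' : Fin 2 → ResidueField R} {l l' : ResidueField R}
    (hg : HasMultiplier R g c' l') (hf : HasMultiplier R f c l)
    (hc : ∀ P, red R P = c → red R (f P) = c') : HasMultiplier R (g ∘ f) c (l' * l) := by
  intro P Q hP hQ
  obtain ⟨r, hr, h⟩ := hf P Q hP hQ
  obtain ⟨r', hr', h'⟩ := hg (f P) (f Q) (hc P hP) (hc Q hQ)
  exact ⟨r' * r, by rw [map_mul, hr, hr'], by rw [Function.comp, Function.comp, h', h, mul_assoc]⟩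

theorem IsResiduallyDifferentiable.comp (hg : IsResiduallyDifferentiable R g)
    (hf : IsResiduallyDifferentiable R f) : IsResiduallyDifferentiable R (g ∘ f) := by
  intro c
  by_cases hc : ∃ P₀, red R P₀ = c
  · obtain ⟨P₀, hP₀⟩ := hc
    obtain ⟨l, hl⟩ := hf c
    obtain ⟨l', hl'⟩ := hg (red R (f P₀))
    exact ⟨_, hl'.comp hl fun P hP => hf.red_congr (hP.trans hP₀.symm)⟩
  · exact ⟨0, fun P Q hP => absurd ⟨P, hP⟩ hc⟩

theorem IsResiduallyDifferentiable.iterate (hf : IsResiduallyDifferentiable R f) (n : ℕ) :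
    IsResiduallyDifferentiable R f^[n] := by
  induction n with
  | zero => exact fun c => ⟨1, fun P Q _ _ => ⟨1, map_one _, by simp⟩⟩
  | succ n ih =>
    rw [Function.iterate_succ]
    exact ih.comp hf

theorem IsResiduallyDifferentiable.red_iterate {P : ProjLine K}
    (hf : IsResiduallyDifferentiable R f) (hP : red R (f P) = red R P) (n : ℕ) {Q : ProjLine K}
    (hQ : red R Q = red R P) :
    red R (f^[n] Q) = red R P := by
  induction n with
  | zero => exact hQ
  | succ n ih =>
    rw [Function.iterate_succ_apply']
    exact (hf.red_congr ih).trans hP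

theorem HasMultiplier.iterate {P : ProjLine K} {l : ResidueField R}
    (hf : IsResiduallyDifferentiable R f) (hP : red R (f P) = red R P)
    (hl : HasMultiplier R f (red R P) l) (n : ℕ) :
    HasMultiplier R f^[n] (red R P) (l ^ n) := by
  induction n with
  | zero => exact fun P Q _ _ => ⟨1, by simp, by simp⟩
  | succ n ih =>
    rw [Function.iterate_succ, pow_succ]
    exact ih.comp hl fun Q hQ => (hf.red_congr hQ).trans hP

/-- For a nontrivial cycle within one residue class, telescoping the separations of successive
points gives a vanishing geometric sum of the multiplier. -/
theorem HasMultiplier.geom_sum_eq_zero {P : ProjLine K} {l : ResidueField R}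
    (hf : IsResiduallyDifferentiable R f) (hP : red R (f P) = red R P)
    (hl : HasMultiplier R f (red R P) l) (hne : f P ≠ P) {n : ℕ} (hn : f^[n] P = P) :
    ∑ i ∈ Finset.range n, l ^ i = 0 := by
  have key : ∀ m, ∃ r : R, residue R r = ∑ i ∈ Finset.range m, l ^ i ∧
      sep R P (f^[m] P) = r * sep R P (f P) := by
    intro m
    induction m with
    | zero => exact ⟨0, by simp, by simp [sep_self]⟩
    | succ m ih =>
      obtain ⟨r, hr, h⟩ := ih
      obtain ⟨r', hr', h'⟩ := hl.iterate hf hP m P (f P) rfl hP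
      refine ⟨r + r', by rw [map_add, hr, hr', Finset.sum_range_succ], ?_⟩
      rw [add_mul, ← h, ← h', ← Function.iterate_succ_apply]
      refine (sep_add R ?_ ?_).symm
      · exact (hf.red_iterate hP m rfl).symm
      · exact (hf.red_iterate hP m rfl).trans
          (hf.red_iterate hP (m + 1) rfl).symm
  obtain ⟨r, hr, h⟩ := key n
  rw [hn, sep_self] at h
  rcases mul_eq_zero.1 h.symm with h0 | h0
  · rw [← hr, h0, map_zero]
  · exact absurd ((sep_eq_zero_iff R).1 h0).symm hne

/-- First-order expansion of the Wronskian-type expression `f(x) g(y) - f(y) g(x)` near the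
residue class of `x₀`. -/
theorem exists_eval_mul_eval_sub_eq {A : Type*} [CommRing A] [IsLocalRing A] (f g : Polynomial A)
    (x₀ : A) :
    ∃ l : ResidueField A, ∀ x y, residue A x = residue A x₀ → residue A y = residue A x₀ →
      ∃ h : A, residue A h = l ∧ f.eval x * g.eval y - f.eval y * g.eval x = (x - y) * h := by
  refine ⟨residue A (f.derivative.eval x₀ * g.eval x₀ - f.eval x₀ * g.derivative.eval x₀),
    fun x y hx hy => ?_⟩
  have hres : ∀ q : Polynomial A, residue A (q.eval y) = residue A (q.eval x₀) := fun q => by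
    rw [← Polynomial.eval₂_at_apply, ← Polynomial.eval₂_at_apply, hy]
  obtain ⟨kf, hkf⟩ := f.binomExpansion y (x - y)
  obtain ⟨kg, hkg⟩ := g.binomExpansion y (x - y)
  rw [add_sub_cancel] at hkf hkg
  refine ⟨(f.derivative.eval y + kf * (x - y)) * g.eval y
    - f.eval y * (g.derivative.eval y + kg * (x - y)), ?_, ?_⟩
  · simp only [map_sub, map_mul, map_add, hx, hy, hres, sub_self, mul_zero, add_zero]
  · rw [hkf, hkg]
    ring

/-- Reduction commutes with the evaluation of a polynomial over `R`. -/
theorem residue_eval_normRep (F : MvPolynomial (Fin 2) R) (P : ProjLine K) :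
    residue R (MvPolynomial.eval (normRep R P) F)
      = MvPolynomial.eval (red R P) (MvPolynomial.map (residue R) F) := by
  rw [MvPolynomial.eval_map, MvPolynomial.eval₂_comp]
  rfl

/-- In a residue class the normalized coordinates are `(x, 1)` or `(1, x)` with `x` in a fixed
class of `R`, so the Wronskian-type expression of two polynomials in two variables is a multiple
of the separation. -/
theorem exists_eval_normRep_sub_eq (F G : MvPolynomial (Fin 2) R) (P₀ : ProjLine K) :
    ∃ l : ResidueField R, ∀ P Q, red R P = red R P₀ → red R Q = red R P₀ →
      ∃ h : R, residue R h = l ∧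
        MvPolynomial.eval (normRep R P) F * MvPolynomial.eval (normRep R Q) G
          - MvPolynomial.eval (normRep R P) G * MvPolynomial.eval (normRep R Q) F
          = h * sep R P Q := by
  have hev : ∀ (u : Fin 2 → Polynomial R) (x : R) (H : MvPolynomial (Fin 2) R),
      (MvPolynomial.aeval u H).eval x = MvPolynomial.eval (fun i => (u i).eval x) H := by
    intro u x H
    rw [MvPolynomial.aeval_def, MvPolynomial.eval₂_eq', MvPolynomial.eval_eq',
      Polynomial.eval_finsetSum]
    simp
  rcases normRep_cases R P₀ with h | ⟨h, h'⟩
  · have hrep : ∀ P, red R P = red R P₀ → normRep R P 1 = 1 := by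
      intro P hP
      have h1 := congrFun hP 1
      rcases normRep_cases R P with hP' | ⟨-, hP'⟩
      · exact hP'
      · simp [red, h, hP'] at h1
    have hevP : ∀ P, red R P = red R P₀ → ∀ H : MvPolynomial (Fin 2) R,
        MvPolynomial.eval (normRep R P) H
          = (MvPolynomial.aeval ![Polynomial.X, 1] H).eval (normRep R P 0) := by
      intro P hP H
      rw [hev]
      congr 2
      ext i
      fin_cases i
      · simp
      · simp [hrep P hP]
    obtain ⟨l, hl⟩ := exists_eval_mul_eval_sub_eq
      (MvPolynomial.aeval ![Polynomial.X, 1] F) (MvPolynomial.aeval ![Polynomial.X, 1] G)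
      (normRep R P₀ 0)
    refine ⟨l, fun P Q hP hQ => ?_⟩
    obtain ⟨r, hr', hr⟩ := hl _ _ (congrFun hP 0) (congrFun hQ 0)
    refine ⟨r, hr', ?_⟩
    simp only [hevP P hP, hevP Q hQ, sep, hrep P hP, hrep Q hQ]
    linear_combination hr
  · have hrep : ∀ P, red R P = red R P₀ → normRep R P 0 = 1 := by
      intro P hP
      have h1 := congrFun hP 1
      rcases normRep_cases R P with hP' | ⟨hP', -⟩
      · simp [red, hP', h'] at h1
      · exact hP'
    have hevP : ∀ P, red R P = red R P₀ → ∀ H : MvPolynomial (Fin 2) R,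
        MvPolynomial.eval (normRep R P) H
          = (MvPolynomial.aeval ![1, Polynomial.X] H).eval (normRep R P 1) := by
      intro P hP H
      rw [hev]
      congr 2
      ext i
      fin_cases i
      · simp [hrep P hP]
      · simp
    obtain ⟨l, hl⟩ := exists_eval_mul_eval_sub_eq
      (MvPolynomial.aeval ![1, Polynomial.X] F) (MvPolynomial.aeval ![1, Polynomial.X] G)
      (normRep R P₀ 1)
    refine ⟨-l, fun P Q hP hQ => ?_⟩
    obtain ⟨r, hr', hr⟩ := hl _ _ (congrFun hP 1) (congrFun hQ 1)
    refine ⟨-r, by rw [map_neg, hr'], ?_⟩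
    simp only [hevP P hP, hevP Q hQ, sep, hrep P hP, hrep Q hQ]
    linear_combination hr

end ProjLine

namespace ProjLineEndo

/-! ### Maps with good reduction -/

open ProjLine

/-- Polynomials of degree `d` whose reduced map has degree `d` have no common zero: the removed
common factor is a constant. -/
theorem RatMapHasDegree.eval_ne_zero {k : Type*} [Field k] {F G : MvPolynomial (Fin 2) k} {d : ℕ}
    (h : RatMapHasDegree F G d) (hF : F.IsHomogeneous d) (hG : G.IsHomogeneous d)
    (hFG : F ≠ 0 ∨ G ≠ 0) {v : Fin 2 → k} (hv : v ≠ 0) :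
    ¬(MvPolynomial.eval v F = 0 ∧ MvPolynomial.eval v G = 0) := by
  obtain ⟨H, F', G', hH, rfl, rfl, hF', hG', hcop⟩ := h
  have hdeg : H.totalDegree = 0 := by
    have aux : ∀ E : MvPolynomial (Fin 2) k, E.IsHomogeneous d → (H * E).IsHomogeneous d →
        H * E ≠ 0 → H.totalDegree = 0 := by
      intro E hE hHE hne
      have h1 := hHE.totalDegree hne
      rw [MvPolynomial.totalDegree_mul_of_isDomain hH (right_ne_zero_of_mul hne),
        hE.totalDegree (right_ne_zero_of_mul hne)] at h1
      omega
    rcases hFG with h | h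
    · exact aux F' hF' hF h
    · exact aux G' hG' hG h
  rw [MvPolynomial.totalDegree_eq_zero_iff_eq_C] at hdeg
  have hc : MvPolynomial.coeff 0 H ≠ 0 := by
    intro h0
    rw [h0, map_zero] at hdeg
    exact hH hdeg
  rintro ⟨h1, h2⟩
  rw [hdeg, map_mul, MvPolynomial.eval_C] at h1 h2
  refine ProjLineEndo.eval_ne_zero ⟨d, F', G', hF', hG', hcop⟩ hv ?_
  ext i
  fin_cases i
  · simpa [hc] using h1
  · simpa [hc] using h2

variable {K : Type*} [Field K] {R : ValuationSubring K}

theorem onPoints_mk (Φ : ProjLineEndo K) {v : Fin 2 → K} (hv : v ≠ 0) :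
    Φ.onPoints (Projectivization.mk K v hv) =
      Projectivization.mk K ![MvPolynomial.eval v Φ.F, MvPolynomial.eval v Φ.G]
        (Φ.eval_ne_zero hv) := rfl

theorem IsReducedForm.residue_eval_ne_zero {Φ : ProjLineEndo K} {F₀ G₀ : MvPolynomial (Fin 2) R}
    (hred : Φ.IsReducedForm R F₀ G₀)
    (hdeg : RatMapHasDegree (MvPolynomial.map (residue R) F₀)
      (MvPolynomial.map (residue R) G₀) Φ.degree) (P : ProjLine K) :
    (fun i => residue R (![MvPolynomial.eval (normRep R P) F₀,
      MvPolynomial.eval (normRep R P) G₀] i)) ≠ 0 := by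
  obtain ⟨⟨c, hc, hF, hG⟩, m, hm⟩ := hred
  have hinj : Function.Injective (algebraMap R K) := Subtype.val_injective
  have hhom : ∀ {A : MvPolynomial (Fin 2) R} {B : MvPolynomial (Fin 2) K},
      MvPolynomial.map (algebraMap R K) A = MvPolynomial.C c * B → B.IsHomogeneous Φ.degree →
      A.IsHomogeneous Φ.degree := by
    intro A B hAB hB
    refine MvPolynomial.IsHomogeneous.of_map hinj ?_
    rw [hAB]
    exact hB.C_mul c
  have hne : ∀ {A : MvPolynomial (Fin 2) R}, IsUnit (A.coeff m) →
      MvPolynomial.map (residue R) A ≠ 0 := by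
    intro A hA h0
    have := congrArg (MvPolynomial.coeff m) h0
    rw [MvPolynomial.coeff_map, MvPolynomial.coeff_zero] at this
    exact (hA.map (residue R)).ne_zero this
  intro h
  refine hdeg.eval_ne_zero ((hhom hF Φ.homogeneous_F).map _) ((hhom hG Φ.homogeneous_G).map _)
    (hm.imp hne hne) (red_ne_zero R P) ⟨?_, ?_⟩
  · rw [← residue_eval_normRep]
    exact congrFun h 0
  · rw [← residue_eval_normRep]
    exact congrFun h 1

/-- The factor `u` between the values of a reduced form at `P` and the normalized coordinates of the
image of `P` is a unit whose residue depends only on the reduction of `P`. -/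
theorem IsReducedForm.exists_eq_smul_normRep_onPoints {Φ : ProjLineEndo K}
    {F₀ G₀ : MvPolynomial (Fin 2) R} (hred : Φ.IsReducedForm R F₀ G₀)
    (hdeg : RatMapHasDegree (MvPolynomial.map (residue R) F₀)
      (MvPolynomial.map (residue R) G₀) Φ.degree) (P : ProjLine K) :
    ∃ u : R, MvPolynomial.eval (normRep R P) F₀ = u * normRep R (Φ.onPoints P) 0 ∧
      MvPolynomial.eval (normRep R P) G₀ = u * normRep R (Φ.onPoints P) 1 ∧
      residue R u = scale ![MvPolynomial.eval (red R P) (MvPolynomial.map (residue R) F₀),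
        MvPolynomial.eval (red R P) (MvPolynomial.map (residue R) G₀)] := by
  have hres := hred.residue_eval_ne_zero hdeg P
  set w : Fin 2 → R := ![MvPolynomial.eval (normRep R P) F₀, MvPolynomial.eval (normRep R P) G₀]
    with hw
  have hw0 : (fun i => (w i : K)) ≠ 0 := by
    intro h
    apply hres
    ext i
    have : w i = 0 := Subtype.ext (congrFun h i)
    rw [this, map_zero, Pi.zero_apply]
  obtain ⟨⟨c, hc, hF, hG⟩, -⟩ := hred
  have hcoe : ∀ {A : MvPolynomial (Fin 2) R} {B : MvPolynomial (Fin 2) K},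
      MvPolynomial.map (algebraMap R K) A = MvPolynomial.C c * B →
      ((MvPolynomial.eval (normRep R P) A : R) : K)
        = c * MvPolynomial.eval (fun i => (normRep R P i : K)) B := by
    intro A B h
    have h1 := congrArg (MvPolynomial.eval (fun i => (normRep R P i : K))) h
    rw [map_mul, MvPolynomial.eval_C, MvPolynomial.eval_map] at h1
    rw [← h1]
    change algebraMap R K _ = _
    rw [MvPolynomial.eval₂_comp]
    rfl
  have hP : Projectivization.mk K (fun i => (w i : K)) hw0 = Φ.onPoints P := by
    conv_rhs => rw [← mk_normRep R P, onPoints_mk]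
    rw [Projectivization.mk_eq_mk_iff']
    refine ⟨c, ?_⟩
    ext i
    fin_cases i
    · simp [hw, hcoe hF]
    · simp [hw, hcoe hG]
  obtain ⟨u, hu, hu'⟩ := exists_eq_smul_normRep R hres hw0 hP
  refine ⟨u, hu 0, hu 1, hu'.trans (congrArg scale ?_)⟩
  ext i
  fin_cases i <;> simp [hw, residue_eval_normRep]

/-- The multiplier on the class of `P₀` is that of the Wronskian-type expression, divided by the
square of the factor normalizing the values of the reduced form there. -/
theorem HasGoodReduction.isResiduallyDifferentiable {Φ : ProjLineEndo K}
    (h : Φ.HasGoodReduction R) : IsResiduallyDifferentiable R Φ.onPoints := by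
  obtain ⟨F₀, G₀, hred, hdeg⟩ := h
  intro c
  by_cases hc : ∃ P₀, red R P₀ = c
  swap
  · exact ⟨0, fun P Q hP => absurd ⟨P, hP⟩ hc⟩
  obtain ⟨P₀, rfl⟩ := hc
  obtain ⟨l, hl⟩ := exists_eval_normRep_sub_eq F₀ G₀ P₀
  obtain ⟨s, hs⟩ : ∃ s, s = scale ![MvPolynomial.eval (red R P₀) (MvPolynomial.map (residue R) F₀),
        MvPolynomial.eval (red R P₀) (MvPolynomial.map (residue R) G₀)] := ⟨_, rfl⟩
  have hs0 : s ≠ 0 := by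
    rw [hs]
    refine scale_ne_zero fun h0 => hred.residue_eval_ne_zero hdeg P₀ ?_
    rw [← h0]
    ext i
    fin_cases i <;> simp [residue_eval_normRep]
  refine ⟨l / (s * s), fun P Q hP hQ => ?_⟩
  obtain ⟨r, hr, hrP⟩ := hl P Q hP hQ
  obtain ⟨u, hu0, hu1, hu⟩ := hred.exists_eq_smul_normRep_onPoints hdeg P
  obtain ⟨u', hu0', hu1', hu'⟩ := hred.exists_eq_smul_normRep_onPoints hdeg Q
  rw [hP, ← hs] at hu
  rw [hQ, ← hs] at hu'
  have hunit : IsUnit (u * u') := by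
    rw [← residue_ne_zero_iff_isUnit, map_mul, hu, hu']
    exact mul_ne_zero hs0 hs0
  obtain ⟨b, hb⟩ := hunit.exists_right_inv
  refine ⟨r * b, ?_, ?_⟩
  · have := congrArg (residue R) hb
    rw [map_mul, map_mul, hu, hu', map_one] at this
    rw [map_mul, hr, div_eq_mul_inv, eq_inv_of_mul_eq_one_right this]
  · rw [hu0, hu1, hu0', hu1'] at hrP
    have h1 : u * u' * sep R (Φ.onPoints P) (Φ.onPoints Q) = r * sep R P Q := by
      rw [← hrP, sep]
      ring
    linear_combination b * h1 - sep R (Φ.onPoints P) (Φ.onPoints Q) * hb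

end ProjLineEndo

namespace ProjLine

section Dynamics

/-! ### Cycles at one place -/

variable {K : Type*} [Field K] {R : ValuationSubring K} {f : ProjLine K → ProjLine K}

theorem IsResiduallyDifferentiable.sep_dvd_iterate (hf : IsResiduallyDifferentiable R f) (n : ℕ)
    (P Q : ProjLine K) : sep R P Q ∣ sep R (f^[n] P) (f^[n] Q) :=
  (hf.iterate n).sep_dvd P Q

theorem associated_sep_comm (P Q : ProjLine K) : Associated (sep R P Q) (sep R Q P) := by
  rw [sep_comm]
  exact (Associated.refl _).neg_left

/-- Along a cycle the separation is invariant under translation of the indices: it can only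
shrink, and it returns to its value after a full period. -/
theorem IsResiduallyDifferentiable.associated_sep_add (hf : IsResiduallyDifferentiable R f)
    {P : ProjLine K} (hP : P ∈ Function.periodicPts f) (i j k : ℕ) :
    Associated (sep R (f^[i] P) (f^[j] P)) (sep R (f^[i + k] P) (f^[j + k] P)) := by
  obtain ⟨n, hn, hnP⟩ := hP
  refine associated_of_dvd_dvd ?_ ?_
  · have := hf.sep_dvd_iterate k (f^[i] P) (f^[j] P)
    rwa [← Function.iterate_add_apply, ← Function.iterate_add_apply, add_comm k, add_comm k] at this
  · have hback : ∀ i, f^[n * k - k] (f^[i + k] P) = f^[i] P := fun i => by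
      have hk : k ≤ n * k := Nat.le_mul_of_pos_left k hn
      rw [← Function.iterate_add_apply, show n * k - k + (i + k) = i + n * k by omega,
        Function.iterate_add_apply, (hnP.mul_const k).eq]
    have := hf.sep_dvd_iterate (n * k - k) (f^[i + k] P) (f^[j + k] P)
    rwa [hback, hback] at this

theorem IsResiduallyDifferentiable.sep_dvd_sep_mul (hf : IsResiduallyDifferentiable R f)
    (P : ProjLine K) (a b : ℕ) : sep R P (f^[a] P) ∣ sep R P (f^[a * b] P) := by
  induction b with
  | zero => simp [sep_self]
  | succ b ih =>
    refine dvd_sep_trans R ih ?_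
    have := hf.sep_dvd_iterate (a * b) P (f^[a] P)
    rwa [← Function.iterate_add_apply] at this

/-- If `i` is prime to the period, some multiple of `i` is `≡ 1`, so that the separations of index
distance `1` and `i` divide each other. -/
theorem IsResiduallyDifferentiable.associated_sep_of_coprime (hf : IsResiduallyDifferentiable R f)
    {P : ProjLine K} {n i : ℕ} (hn : f^[n] P = P) (hi : Nat.Coprime i n) :
    Associated (sep R P (f P)) (sep R P (f^[i] P)) := by
  refine associated_of_dvd_dvd ?_ ?_
  · simpa using hf.sep_dvd_sep_mul P 1 i
  · by_cases h1 : n = 1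
    · subst h1
      rw [show f P = P from hn, sep_self]
      exact dvd_zero _
    by_cases h0 : n = 0
    · subst h0
      rw [Nat.coprime_zero_right] at hi
      subst hi
      rfl
    obtain ⟨b, hb⟩ := Nat.exists_mul_mod_eq_one_of_coprime hi (by omega)
    have := hf.sep_dvd_sep_mul P i b
    have hper : Function.IsPeriodicPt f n P := hn
    rw [← hper.iterate_mod_apply (i * b), hb.2] at this
    exact this

theorem minimalPeriod_iterate_of_dvd {α : Type*} {f : α → α} {x : α} {d : ℕ}
    (hx : x ∈ Function.periodicPts f) (hd : d ∣ Function.minimalPeriod f x) :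
    Function.minimalPeriod f^[d] x = Function.minimalPeriod f x / d := by
  have hpos := Function.minimalPeriod_pos_of_mem_periodicPts hx
  rw [Function.minimalPeriod_iterate_eq_div_gcd (Nat.pos_of_dvd_of_pos hd hpos).ne',
    Nat.gcd_eq_right hd]

theorem mem_periodicPts_iterate {α : Type*} {f : α → α} {x : α}
    (hx : x ∈ Function.periodicPts f) (d : ℕ) : x ∈ Function.periodicPts f^[d] := by
  obtain ⟨n, hn, h⟩ := hx
  exact ⟨n, hn, h.iterate d⟩

/-- The period of the reduction of a cycle divides the period of the cycle and is at most the
number of points of the projective line over the residue field. -/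
theorem IsResiduallyDifferentiable.exists_red_period (hf : IsResiduallyDifferentiable R f)
    [Fintype (ResidueField R)] {P : ProjLine K} (hP : P ∈ Function.periodicPts f) :
    ∃ m, 0 < m ∧ m ≤ Fintype.card (ResidueField R) + 1 ∧ m ∣ Function.minimalPeriod f P ∧
      red R (f^[m] P) = red R P := by
  classical
  have hper := Function.isPeriodicPt_minimalPeriod f P
  have hpos := Function.minimalPeriod_pos_of_mem_periodicPts hP
  set n := Function.minimalPeriod f P
  have hex : ∃ m, 0 < m ∧ red R (f^[m] P) = red R P := ⟨n, hpos, by rw [hper.eq]⟩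
  refine ⟨Nat.find hex, (Nat.find_spec hex).1, ?_, ?_, (Nat.find_spec hex).2⟩
  · have ho : ∀ Q : ProjLine K, ∃ o : Option (ResidueField R),
        red R Q = o.elim ![1, 0] fun x => ![x, 1] := by
      intro Q
      rcases red_cases R Q with h | h
      · refine ⟨some (red R Q 0), ?_⟩
        ext i
        fin_cases i <;> simp [h]
      · exact ⟨none, h⟩
    choose o ho using ho
    obtain ⟨i, j, hij, hoij⟩ := Fintype.exists_ne_map_eq_of_card_lt
      (fun i : Fin (Fintype.card (ResidueField R) + 2) => o (f^[i] P)) (by simp)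
    have hred : red R (f^[i] P) = red R (f^[j] P) := by rw [ho, ho, hoij]
    -- the reduction of the orbit is purely periodic, so a coincidence can be shifted to index `0`
    have aux : ∀ a b : ℕ, a < b → red R (f^[a] P) = red R (f^[b] P) →
        b < Fintype.card (ResidueField R) + 2 →
          Nat.find hex ≤ Fintype.card (ResidueField R) + 1 := by
      intro a b hab h hb
      have h1 := (hf.iterate (n * a - a)).red_congr h
      have ha : a ≤ n * a := Nat.le_mul_of_pos_left a hpos
      rw [← Function.iterate_add_apply, ← Function.iterate_add_apply,
        show n * a - a + a = n * a by omega, (hper.mul_const a).eq,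
        show n * a - a + b = b - a + n * a by omega, Function.iterate_add_apply,
        (hper.mul_const a).eq] at h1
      exact (Nat.find_min' hex ⟨by omega, h1.symm⟩).trans (by omega)
    rcases lt_or_gt_of_ne (Fin.val_ne_of_ne hij) with h | h
    · exact aux i j h hred j.2
    · exact aux j i h hred.symm i.2
  · have hm := Nat.find_spec hex
    set m := Nat.find hex
    rw [Nat.dvd_iff_mod_eq_zero]
    by_contra hne
    refine absurd (Nat.mod_lt n hm.1) (not_lt.2 ?_)
    refine Nat.find_min' hex ⟨Nat.pos_of_ne_zero hne, ?_⟩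
    have hq : red R (f^[m * (n / m)] P) = red R P := by
      rw [Function.iterate_mul]
      exact (hf.iterate m).red_iterate hm.2 _ rfl
    have h1 := (hf.iterate (n % m)).red_congr hq
    rw [← Function.iterate_add_apply, Nat.mod_add_div, hper.eq] at h1
    exact h1.symm

/-- A cycle within one residue class, over a residue field with `p` elements: the period divides
`p - 1`, the possible orders of the multiplier, up to a factor that is `1`, `p`, or divisible
by `p ^ 2`. -/
theorem IsResiduallyDifferentiable.period_of_red_eq (hf : IsResiduallyDifferentiable R f)
    [Fintype (ResidueField R)] {p : ℕ} (hcard : Fintype.card (ResidueField R) = p)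
    [CharP (ResidueField R) p] {P : ProjLine K} (hP : P ∈ Function.periodicPts f)
    (hred : red R (f P) = red R P) :
    p ^ 2 ∣ Function.minimalPeriod f P ∨ ∃ r, r ∣ p - 1 ∧
      (Function.minimalPeriod f P = r ∨ Function.minimalPeriod f P = r * p) := by
  by_cases hfix : f P = P
  · right
    exact ⟨1, one_dvd _, Or.inl (Function.minimalPeriod_eq_one_iff_isFixedPt.2 hfix)⟩
  have hpos := Function.minimalPeriod_pos_of_mem_periodicPts hP
  have hper := Function.iterate_minimalPeriod (f := f) (x := P)
  obtain ⟨l, hl⟩ := hf (red R P)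
  have hsum := hl.geom_sum_eq_zero hf hred hfix hper
  have hpow : l ^ Function.minimalPeriod f P = 1 := by
    rw [← sub_eq_zero, ← geom_sum_mul, hsum, zero_mul]
  have hl0 : l ≠ 0 := by
    rintro rfl
    rw [zero_pow hpos.ne'] at hpow
    exact zero_ne_one hpow
  have hr : orderOf l ∣ p - 1 := by
    rw [orderOf_dvd_iff_pow_eq_one, ← hcard]
    exact FiniteField.pow_card_sub_one_eq_one l hl0
  have hrn : orderOf l ∣ Function.minimalPeriod f P := orderOf_dvd_of_pow_eq_one hpow
  -- an iterate with multiplier `1` has period `1` or a multiple of `p`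
  have step : ∀ d, d ∣ Function.minimalPeriod f P → l ^ d = 1 →
      Function.minimalPeriod f P = d ∨ d * p ∣ Function.minimalPeriod f P := by
    intro d hd hld
    have hmin := minimalPeriod_iterate_of_dvd hP hd
    by_cases hfix' : f^[d] P = P
    · left
      exact Nat.dvd_antisymm (Function.IsPeriodicPt.minimalPeriod_dvd hfix') hd
    · right
      have h1 := (hl.iterate hf hred d).geom_sum_eq_zero (hf.iterate d)
        (hf.red_iterate hred d rfl) hfix'
        (Function.iterate_minimalPeriod (f := f^[d]) (x := P))
      rw [hld] at h1
      simp only [one_pow, Finset.sum_const, Finset.card_range, nsmul_eq_mul, mul_one] at h1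
      rw [CharP.cast_eq_zero_iff (ResidueField R) p, hmin] at h1
      exact (Nat.dvd_div_iff_mul_dvd hd).1 h1
  rcases step _ hrn (pow_orderOf_eq_one l) with h | h
  · exact Or.inr ⟨_, hr, Or.inl h⟩
  · rcases step _ h (by rw [pow_mul, pow_orderOf_eq_one, one_pow]) with h' | h'
    · exact Or.inr ⟨_, hr, Or.inr h'⟩
    · left
      rw [mul_assoc, ← sq] at h'
      exact (dvd_mul_left _ _).trans h'

end Dynamics

section CrossRatio

/-! ### Cross-ratios that are units at all finite places -/

variable {K : Type*} [Field K]

/-- The determinant of the chosen homogeneous coordinates of two points. -/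
noncomputable def det (P Q : ProjLine K) : K := P.rep 0 * Q.rep 1 - P.rep 1 * Q.rep 0

theorem exists_sep_eq_mul_det (R : ValuationSubring K) :
    ∃ s : ProjLine K → K, (∀ P, s P ≠ 0) ∧
      ∀ P Q, (sep R P Q : K) = s P * s Q * det P Q := by
  have h : ∀ P : ProjLine K, ∃ s : K, s ≠ 0 ∧ ∀ i, (normRep R P i : K) = s * P.rep i := by
    intro P
    have hP := mk_normRep R P
    conv_rhs at hP => rw [← P.mk_rep]
    rw [Projectivization.mk_eq_mk_iff'] at hP
    obtain ⟨a, ha⟩ := hP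
    refine ⟨a, ?_, fun i => (congrFun ha i).symm⟩
    rintro rfl
    exact normRep_ne_zero R P (by rw [← ha, zero_smul])
  choose s hs hrep using h
  refine ⟨s, hs, fun P Q => ?_⟩
  simp only [sep, det, MulMemClass.coe_mul, AddSubgroupClass.coe_sub, hrep]
  ring

theorem det_eq_zero_iff {P Q : ProjLine K} : det P Q = 0 ↔ P = Q := by
  obtain ⟨s, hs, h⟩ := exists_sep_eq_mul_det (⊤ : ValuationSubring K)
  rw [← sep_eq_zero_iff (⊤ : ValuationSubring K), ← ZeroMemClass.coe_eq_zero, h]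
  simp [hs]

end CrossRatio

end ProjLine

open ProjLine

theorem exists_eq_C_of_mem_finitePlaceRing {p : ℕ} [Fact p.Prime] {c : RatFunc (ZMod p)}
    (hc0 : c ≠ 0) (hc : ∀ v, c ∈ finitePlaceRing p v) (hc' : ∀ v, c⁻¹ ∈ finitePlaceRing p v) :
    ∃ a : (ZMod p)ˣ, c = algebraMap (Polynomial (ZMod p)) _ (Polynomial.C (a : ZMod p)) := by
  obtain ⟨f, hf⟩ := IsDedekindDomain.HeightOneSpectrum.mem_integers_of_valuation_le_one
    (R := Polynomial (ZMod p)) (RatFunc (ZMod p)) c hc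
  obtain ⟨g, hg⟩ := IsDedekindDomain.HeightOneSpectrum.mem_integers_of_valuation_le_one
    (R := Polynomial (ZMod p)) (RatFunc (ZMod p)) c⁻¹ hc'
  have hfg : f * g = 1 := by
    apply IsFractionRing.injective (Polynomial (ZMod p)) (RatFunc (ZMod p))
    rw [map_mul, hf, hg, mul_inv_cancel₀ hc0, map_one]
  obtain ⟨a, ha, rfl⟩ := Polynomial.isUnit_iff.1 (IsUnit.of_mul_eq_one g hfg)
  exact ⟨ha.unit, hf.symm⟩

/-- If the cross-ratios of `P`, `Q` and any two of the points `S j` are units at all finite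
places, they lie in `𝔽_pˣ`; as they determine the points, there are at most `p - 1` points. -/
theorem card_lt_of_associated_sep {p : ℕ} [Fact p.Prime] {J : Type*} [Fintype J]
    {P Q : ProjLine (RatFunc (ZMod p))} {S : J → ProjLine (RatFunc (ZMod p))}
    (hS : Function.Injective S) (hPQ : P ≠ Q) (hP : ∀ j, P ≠ S j) (hQ : ∀ j, Q ≠ S j)
    (h : ∀ v i j, Associated
      (sep (finitePlaceRing p v) P (S i) * sep (finitePlaceRing p v) Q (S j))
      (sep (finitePlaceRing p v) P (S j) * sep (finitePlaceRing p v) Q (S i))) :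
    Fintype.card J < p := by
  have hp := (Fact.out : p.Prime).pos
  rcases isEmpty_or_nonempty J with hJ | ⟨⟨j₀⟩⟩
  · simpa using hp
  let c : J → RatFunc (ZMod p) := fun j =>
    (det P (S j) * det Q (S j₀)) / (det P (S j₀) * det Q (S j))
  have hdP : ∀ j, det P (S j) ≠ 0 := fun j => det_eq_zero_iff.not.2 (hP j)
  have hdQ : ∀ j, det Q (S j) ≠ 0 := fun j => det_eq_zero_iff.not.2 (hQ j)
  have hmem : ∀ v i j, (det P (S i) * det Q (S j)) / (det P (S j) * det Q (S i))
      ∈ finitePlaceRing p v := by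
    intro v i j
    obtain ⟨s, hs, hsep⟩ := exists_sep_eq_mul_det (finitePlaceRing p v)
    obtain ⟨u, hu⟩ := h v j i
    have hu' := congrArg Subtype.val hu
    simp only [MulMemClass.coe_mul, hsep] at hu'
    have : (det P (S i) * det Q (S j)) / (det P (S j) * det Q (S i))
        = ((u : finitePlaceRing p v) : RatFunc (ZMod p)) := by
      rw [div_eq_iff (mul_ne_zero (hdP j) (hdQ i))]
      have hs4 : s P * s Q * s (S i) * s (S j) ≠ 0 := by simp [hs]
      apply mul_left_cancel₀ hs4
      linear_combination -hu'
    rw [this]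
    exact SetLike.coe_mem _
  have hc : ∀ j, ∃ a : (ZMod p)ˣ,
      c j = algebraMap (Polynomial (ZMod p)) _ (Polynomial.C (a : ZMod p)) := by
    intro j
    refine exists_eq_C_of_mem_finitePlaceRing ?_ (fun v => hmem v j j₀) (fun v => ?_)
    · exact div_ne_zero (mul_ne_zero (hdP j) (hdQ j₀)) (mul_ne_zero (hdP j₀) (hdQ j))
    · rw [inv_div]
      exact hmem v j₀ j
  choose a ha using hc
  have hinj : Function.Injective a := by
    intro i j hij
    have hcij : c i = c j := by rw [ha, ha, hij]
    have h1 : det P (S i) * det Q (S j) = det P (S j) * det Q (S i) := by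
      have hi := hdP j₀
      have hi' := hdQ j₀
      have hi1 := hdQ i
      have hj1 := hdQ j
      simp only [c] at hcij
      rw [div_eq_div_iff (by simp [*]) (by simp [*])] at hcij
      apply mul_left_cancel₀ (mul_ne_zero hi hi')
      linear_combination hcij
    -- the Plücker relation
    have h2 : det P Q * det (S i) (S j) = 0 := by
      unfold det at h1 ⊢
      linear_combination h1
    rcases mul_eq_zero.1 h2 with h3 | h3
    · exact absurd (det_eq_zero_iff.1 h3) hPQ
    · exact hS (det_eq_zero_iff.1 h3)
  have := Fintype.card_le_of_injective a hinj
  rw [ZMod.card_units p] at this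
  omega

/-! ### The residue field at `t = 0` -/

/-- Every residue at the place `t = 0` comes from `𝔽_p`: a fraction `a / b` that is regular at
`t = 0` is congruent to `a(0) / b(0)`. -/
theorem exists_residue_eq_natCast {p : ℕ} [Fact p.Prime]
    (x : ResidueField (finitePlaceRing p (Polynomial.idealX (ZMod p)))) : ∃ n : ℕ, x = n := by
  revert x
  generalize hv : Polynomial.idealX (ZMod p) = v
  intro x
  obtain ⟨⟨c, hc⟩, hx⟩ := residue_surjective x
  have hlt : ∀ q : Polynomial (ZMod p),
      v.valuation (RatFunc (ZMod p)) (algebraMap _ _ q) < 1 ↔ q.coeff 0 = 0 := by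
    intro q
    rw [IsDedekindDomain.HeightOneSpectrum.valuation_lt_one_iff_mem, ← hv, Polynomial.idealX_span,
      Ideal.mem_span_singleton, Polynomial.X_dvd_iff]
  have hle : ∀ q : Polynomial (ZMod p),
      v.valuation (RatFunc (ZMod p)) (algebraMap _ _ q) ≤ 1 := fun q => v.valuation_le_one q
  have hc1 : v.valuation (RatFunc (ZMod p)) c ≤ 1 := hc
  obtain ⟨a, b, hab, hb0, hcab⟩ : ∃ a b : Polynomial (ZMod p), IsCoprime a b ∧ b ≠ 0 ∧
      c = algebraMap _ _ a / algebraMap _ _ b :=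
    ⟨c.num, c.denom, c.isCoprime_num_denom, c.denom_ne_zero, c.num_div_denom.symm⟩
  subst hcab
  have hbK : algebraMap (Polynomial (ZMod p)) (RatFunc (ZMod p)) b ≠ 0 := by
    simpa using hb0
  have hb : b.coeff 0 ≠ 0 := by
    intro h
    have hvb := (hlt b).2 h
    rw [map_div₀, div_le_one₀ ((Valuation.pos_iff _).2 hbK)] at hc1
    have ha := (hlt a).1 (hc1.trans_lt hvb)
    exact Polynomial.not_isUnit_X (hab.isUnit_of_dvd' (Polynomial.X_dvd_iff.2 ha)
      (Polynomial.X_dvd_iff.2 h))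
  have hvb : v.valuation (RatFunc (ZMod p)) (algebraMap _ _ b) = 1 :=
    le_antisymm (hle b) (not_lt.1 fun h => hb ((hlt b).1 h))
  obtain ⟨n, hn⟩ : ∃ n : ℕ, (n : ZMod p) = a.coeff 0 / b.coeff 0 :=
    ⟨_, ZMod.natCast_zmod_val _⟩
  refine ⟨n, ?_⟩
  rw [← map_natCast (residue _), ← hx, ← sub_eq_zero, ← map_sub, residue_eq_zero_iff,
    mem_maximalIdeal, mem_nonunits_iff]
  intro hu
  obtain ⟨y, hy⟩ := hu.exists_right_inv
  have hy' := congrArg (fun z => v.valuation (RatFunc (ZMod p)) (Subtype.val z)) hy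
  simp only [MulMemClass.coe_mul, map_mul, OneMemClass.coe_one, map_one] at hy'
  have hlt1 : v.valuation (RatFunc (ZMod p))
      (algebraMap _ _ a / algebraMap _ _ b - (n : RatFunc (ZMod p))) < 1 := by
    have : algebraMap _ (RatFunc (ZMod p)) a / algebraMap _ _ b - (n : RatFunc (ZMod p))
        = algebraMap _ _ (a - n * b) / algebraMap _ _ b := by
      rw [map_sub, map_mul, map_natCast]
      field_simp
    rw [this, map_div₀, hvb, div_one, hlt, Polynomial.coeff_sub, Polynomial.coeff_natCast_mul,
      hn]
    field_simp
    ring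
  have hy1 : v.valuation (RatFunc (ZMod p)) (y : RatFunc (ZMod p)) ≤ 1 := y.2
  exact absurd hy' (mul_lt_one_of_lt_of_le hlt1 hy1).ne

instance charP_residueField_idealX {p : ℕ} [Fact p.Prime] :
    CharP (ResidueField (finitePlaceRing p (Polynomial.idealX (ZMod p)))) p := by
  refine ringChar.of_eq (CharP.ringChar_of_prime_eq_zero Fact.out ?_)
  rw [← map_natCast (residue _), show ((p : ℕ) : finitePlaceRing p (Polynomial.idealX (ZMod p))) = 0
    from Subtype.ext (by simp), map_zero]

theorem card_residueField_idealX {p : ℕ} [Fact p.Prime] :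
    Nat.card (ResidueField (finitePlaceRing p (Polynomial.idealX (ZMod p)))) = p := by
  have hbij : Function.Bijective
      (ZMod.castHom dvd_rfl (ResidueField (finitePlaceRing p (Polynomial.idealX (ZMod p))))) := by
    refine ⟨RingHom.injective _, fun x => ?_⟩
    obtain ⟨n, rfl⟩ := exists_residue_eq_natCast x
    exact ⟨n, map_natCast _ n⟩
  rw [← Nat.card_congr (Equiv.ofBijective _ hbij), Nat.card_zmod]

section Cycles

/-! ### Exclusion of cycle lengths -/

variable {p : ℕ} [Fact p.Prime] {f : ProjLine (RatFunc (ZMod p)) → ProjLine (RatFunc (ZMod p))}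
  {P : ProjLine (RatFunc (ZMod p))}

/-- For odd `p`, a cycle of length `p ^ 2` would give the `p` points with index `≡ 2` modulo `p`,
whose separations from the points with index `0` and `1` all agree up to units. -/
theorem not_sq_dvd_minimalPeriod (hp : 3 ≤ p)
    (hf : ∀ v, IsResiduallyDifferentiable (finitePlaceRing p v) f)
    (hP : P ∈ Function.periodicPts f) : ¬p ^ 2 ∣ Function.minimalPeriod f P := by
  intro hdvd
  have hprime : p.Prime := Fact.out
  have hpos := Function.minimalPeriod_pos_of_mem_periodicPts hP
  obtain ⟨d, hd⟩ := hdvd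
  have hd0 : 0 < d := Nat.pos_of_ne_zero fun h => by simp [h] at hd; omega
  set g := f^[d] with hg
  have hgper : P ∈ Function.periodicPts g := mem_periodicPts_iterate hP d
  have hmin : Function.minimalPeriod g P = p ^ 2 := by
    rw [hg, minimalPeriod_iterate_of_dvd hP (Dvd.intro_left _ hd.symm), hd,
      Nat.mul_div_cancel _ hd0]
  have hgd : ∀ v, IsResiduallyDifferentiable (finitePlaceRing p v) g := fun v => (hf v).iterate d
  have hlt : ∀ j : Fin p, 2 + p * (j : ℕ) < p ^ 2 := by
    intro j
    have : p * (j + 1) ≤ p * p := Nat.mul_le_mul_left p j.2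
    rw [sq]
    linarith
  have hinj : ∀ a b, a < p ^ 2 → b < p ^ 2 → (g^[a] P = g^[b] P ↔ a = b) := by
    intro a b ha hb
    exact Function.iterate_eq_iterate_iff_of_lt_minimalPeriod (hmin ▸ ha) (hmin ▸ hb)
  have hp2 : 1 < p ^ 2 := Nat.one_lt_pow two_ne_zero hprime.one_lt
  have hcop : ∀ i j, i = 1 ∨ i = 2 → Nat.Coprime (i + p * j) (p ^ 2) := by
    intro i j hi
    refine Nat.Coprime.pow_right 2 ?_
    rw [Nat.coprime_add_mul_left_left]
    refine (Nat.coprime_of_lt_prime ?_ ?_ hprime).symm <;> omega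
  have hgp : g^[p ^ 2] P = P := hmin ▸ Function.iterate_minimalPeriod
  have hcard := card_lt_of_associated_sep (J := Fin p) (P := P) (Q := g P)
    (S := fun j => g^[2 + p * (j : ℕ)] P) ?_ ?_ ?_ ?_ ?_
  · simp at hcard
  · intro i j hij
    have h1 := (hinj _ _ (hlt i) (hlt j)).1 hij
    ext
    exact Nat.eq_of_mul_eq_mul_left hprime.pos (by omega)
  · intro h
    have := (hinj 0 1 (by omega) hp2).1 h
    omega
  · intro j h
    have := (hinj 0 _ (by omega) (hlt j)).1 h
    omega
  · intro j h
    have := (hinj 1 _ hp2 (hlt j)).1 h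
    omega
  · intro v i j
    have h0 : ∀ i : Fin p, Associated (sep (finitePlaceRing p v) P (g^[2 + p * (i : ℕ)] P))
        (sep (finitePlaceRing p v) P (g P)) := fun i =>
      ((hgd v).associated_sep_of_coprime hgp (hcop 2 i (Or.inr rfl))).symm
    have h1 : ∀ i : Fin p, Associated (sep (finitePlaceRing p v) (g P) (g^[2 + p * (i : ℕ)] P))
        (sep (finitePlaceRing p v) P (g P)) := by
      intro i
      have h2 := (hgd v).associated_sep_add hgper 0 (1 + p * i) 1
      rw [show 1 + p * (i : ℕ) + 1 = 2 + p * i by ring] at h2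
      exact h2.symm.trans ((hgd v).associated_sep_of_coprime hgp (hcop 1 i (Or.inl rfl))).symm
    exact ((h0 i).mul_mul (h1 j)).trans ((h0 j).mul_mul (h1 i)).symm

end Cycles

section Binary

variable {f : ProjLine (RatFunc (ZMod 2)) → ProjLine (RatFunc (ZMod 2))}
  {P : ProjLine (RatFunc (ZMod 2))}

/-- As `𝔽₂ˣ` is trivial, no cross-ratio of four distinct points is a unit at all finite places. -/
theorem not_associated_sep_two {A B C D : ProjLine (RatFunc (ZMod 2))} (hCD : C ≠ D) (hAB : A ≠ B)
    (hAC : A ≠ C) (hAD : A ≠ D) (hBC : B ≠ C) (hBD : B ≠ D) :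
    ¬∀ v, Associated (sep (finitePlaceRing 2 v) A C * sep (finitePlaceRing 2 v) B D)
      (sep (finitePlaceRing 2 v) A D * sep (finitePlaceRing 2 v) B C) := by
  intro h
  have := card_lt_of_associated_sep (J := Fin 2) (P := A) (Q := B) (S := ![C, D]) ?_ hAB ?_ ?_ ?_
  · simp at this
  · intro i j
    fin_cases i <;> fin_cases j <;> simp [hCD, hCD.symm]
  · intro j
    fin_cases j <;> simpa
  · intro j
    fin_cases j <;> simpa
  · intro v i j
    fin_cases i <;> fin_cases j
    · exact Associated.refl _
    · exact h v
    · exact (h v).symm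
    · exact Associated.refl _

theorem minimalPeriod_ne_four (hf : ∀ v, IsResiduallyDifferentiable (finitePlaceRing 2 v) f)
    (hP : P ∈ Function.periodicPts f) : Function.minimalPeriod f P ≠ 4 := by
  intro hmin
  have hinj : ∀ a b, a < 4 → b < 4 → a ≠ b → f^[a] P ≠ f^[b] P := by
    intro a b ha hb
    exact (Function.iterate_eq_iterate_iff_of_lt_minimalPeriod (hmin ▸ ha) (hmin ▸ hb)).not.2
  have hper : f^[4] P = f^[0] P := hmin ▸ Function.iterate_minimalPeriod
  refine not_associated_sep_two (A := f^[0] P) (B := f^[2] P) (C := f^[1] P) (D := f^[3] P)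
    (hinj _ _ ?_ ?_ ?_) (hinj _ _ ?_ ?_ ?_) (hinj _ _ ?_ ?_ ?_) (hinj _ _ ?_ ?_ ?_)
    (hinj _ _ ?_ ?_ ?_) (hinj _ _ ?_ ?_ ?_) fun v => ?_
  any_goals norm_num
  have h := (hf v).associated_sep_add hP
  have h03 := h 0 1 3
  rw [Nat.zero_add, show 1 + 3 = 4 from rfl, hper] at h03
  exact (h03.trans (associated_sep_comm _ _)).mul_mul
    (((h 0 1 2).symm.trans (h 0 1 1)).trans (associated_sep_comm _ _))

theorem minimalPeriod_ne_six (hf : ∀ v, IsResiduallyDifferentiable (finitePlaceRing 2 v) f)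
    (hP : P ∈ Function.periodicPts f) : Function.minimalPeriod f P ≠ 6 := by
  intro hmin
  have hinj : ∀ a b, a < 6 → b < 6 → a ≠ b → f^[a] P ≠ f^[b] P := by
    intro a b ha hb
    exact (Function.iterate_eq_iterate_iff_of_lt_minimalPeriod (hmin ▸ ha) (hmin ▸ hb)).not.2
  have hper : f^[6] P = f^[0] P := hmin ▸ Function.iterate_minimalPeriod
  refine not_associated_sep_two (A := f^[1] P) (B := f^[4] P) (C := f^[0] P) (D := f^[2] P)
    (hinj _ _ ?_ ?_ ?_) (hinj _ _ ?_ ?_ ?_) (hinj _ _ ?_ ?_ ?_) (hinj _ _ ?_ ?_ ?_)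
    (hinj _ _ ?_ ?_ ?_) (hinj _ _ ?_ ?_ ?_) fun v => ?_
  any_goals norm_num
  have h := (hf v).associated_sep_add hP
  have h24 := h 2 4 2
  rw [show 4 + 2 = 6 from rfl, hper] at h24
  exact ((associated_sep_comm _ _).trans (h 0 1 1)).mul_mul ((associated_sep_comm _ _).trans h24)

end Binary

section Tails

/-! ### Tails of preperiodic orbits -/

variable {p : ℕ} [Fact p.Prime] {g : ProjLine (RatFunc (ZMod p)) → ProjLine (RatFunc (ZMod p))}

/-- A point cannot reach a fixed point after exactly `p + 1` steps. Along such a path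
`x₀, …, x_{p+1}` the separation of `x i` and `x j`, `i < j`, depends only on `i` up to units, so
the cross-ratios of `x_{p+1}`, `x_p` and any two of the other `p` points are units. -/
theorem isFixedPt_of_isFixedPt_succ (hg : ∀ v, IsResiduallyDifferentiable (finitePlaceRing p v) g)
    {S : ProjLine (RatFunc (ZMod p))} (hS : g (g^[p + 1] S) = g^[p + 1] S) :
    g (g^[p] S) = g^[p] S := by
  by_contra hne
  have hfix : ∀ m, p + 1 ≤ m → g^[m] S = g^[p + 1] S := by
    intro m hm
    obtain ⟨k, rfl⟩ := Nat.exists_eq_add_of_le' hm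
    rw [Function.iterate_add_apply]
    exact Function.iterate_fixed hS k
  have hassoc : ∀ v i j, i < j → Associated (sep (finitePlaceRing p v) (g^[i] S) (g^[j] S))
      (sep (finitePlaceRing p v) (g^[i] S) (g^[p + 1] S)) := by
    intro v i j hij
    have hmove : ∀ k, g^[k] (g^[i] S) = g^[i + k] S := fun k => by
      rw [← Function.iterate_add_apply, add_comm]
    refine associated_of_dvd_dvd ?_ ?_
    · have h := (hg v).sep_dvd_sep_mul (g^[i] S) (j - i) (p + 1)
      rw [hmove, hmove, show i + (j - i) = j by omega] at h
      have hle : p + 1 ≤ (j - i) * (p + 1) := Nat.le_mul_of_pos_left _ (by omega)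
      rwa [hfix _ (by omega : p + 1 ≤ i + (j - i) * (p + 1))] at h
    · have h := (hg v).sep_dvd_iterate (j - i) (g^[i] S) (g^[p + 1] S)
      rw [hmove, show i + (j - i) = j by omega, Function.iterate_fixed hS] at h
      exact dvd_sep_trans _ dvd_rfl
        (h.trans (associated_sep_comm _ _).dvd)
  have hdist : ∀ i j, i < j → i ≤ p → g^[i] S ≠ g^[j] S := by
    intro i j hij hi h
    obtain ⟨v⟩ : Nonempty (IsDedekindDomain.HeightOneSpectrum (Polynomial (ZMod p))) :=
      ⟨Polynomial.idealX (ZMod p)⟩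
    have h0 := (hassoc v i j hij).symm
    rw [← h, sep_self, associated_zero_iff_eq_zero, sep_eq_zero_iff] at h0
    apply hne
    have h1 : g^[p] S = g^[p + 1] S := by
      have := congrArg g^[p - i] h0
      rw [← Function.iterate_add_apply, Function.iterate_fixed hS,
        show p - i + i = p by omega] at this
      exact this
    rw [h1, hS]
  have hcard := card_lt_of_associated_sep (J := Fin p) (P := g^[p + 1] S) (Q := g^[p] S)
    (S := fun j => g^[(j : ℕ)] S) ?_ ?_ ?_ ?_ ?_
  · simp at hcard
  · intro i j hij
    by_contra hij'
    rcases lt_or_gt_of_ne (Fin.val_ne_of_ne hij') with h | h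
    · exact hdist _ _ h i.2.le hij
    · exact hdist _ _ h j.2.le hij.symm
  · exact (hdist _ _ p.lt_succ_self le_rfl).symm
  · exact fun j => (hdist _ _ (j.2.trans p.lt_succ_self) j.2.le).symm
  · exact fun j => (hdist _ _ j.2 j.2.le).symm
  · intro v i j
    have key : ∀ i : Fin p, Associated (sep (finitePlaceRing p v) (g^[p] S) (g^[(i : ℕ)] S))
        (sep (finitePlaceRing p v) (g^[p + 1] S) (g^[(i : ℕ)] S)) := fun i =>
      ((associated_sep_comm _ _).trans (hassoc v i p i.2)).trans (associated_sep_comm _ _)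
    rw [mul_comm (sep _ (g^[p + 1] S) (g^[(j : ℕ)] S))]
    exact ((key i).symm).mul_mul (key j)

end Tails

section Bounds

/-! ### Bounds for periods and orbits -/

variable {p : ℕ} [Fact p.Prime] {f : ProjLine (RatFunc (ZMod p)) → ProjLine (RatFunc (ZMod p))}
  {P : ProjLine (RatFunc (ZMod p))}

/-- At the place `t = 0` the period of a cycle is the product of a period `m` on the `p + 1` points
over the residue field and of the period of a cycle within one residue class. -/
theorem exists_period_eq_mul
    (hf : IsResiduallyDifferentiable (finitePlaceRing p (Polynomial.idealX (ZMod p))) f)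
    (hP : P ∈ Function.periodicPts f) :
    ∃ m n, 0 < m ∧ m ≤ p + 1 ∧ Function.minimalPeriod f P = m * n ∧
      (p ^ 2 ∣ n ∨ ∃ r, r ∣ p - 1 ∧ (n = r ∨ n = r * p)) := by
  have hprime : p.Prime := Fact.out
  have hcard := card_residueField_idealX (p := p)
  have : Finite (ResidueField (finitePlaceRing p (Polynomial.idealX (ZMod p)))) :=
    Nat.finite_of_card_ne_zero (by rw [hcard]; exact hprime.ne_zero)
  have := Fintype.ofFinite (ResidueField (finitePlaceRing p (Polynomial.idealX (ZMod p))))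
  rw [Nat.card_eq_fintype_card] at hcard
  obtain ⟨m, hm0, hm, hmd, hred⟩ := hf.exists_red_period hP
  have h := (hf.iterate m).period_of_red_eq hcard (mem_periodicPts_iterate hP m) hred
  rw [minimalPeriod_iterate_of_dvd hP hmd] at h
  exact ⟨m, _, hm0, hcard ▸ hm, (Nat.mul_div_cancel' hmd).symm, h⟩

theorem minimalPeriod_le (hp : 3 ≤ p)
    (hf : ∀ v, IsResiduallyDifferentiable (finitePlaceRing p v) f)
    (hP : P ∈ Function.periodicPts f) : Function.minimalPeriod f P ≤ (p ^ 2 - 1) * p := by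
  obtain ⟨m, n, -, hm, hmn, h⟩ := exists_period_eq_mul (hf _) hP
  have hsq := not_sq_dvd_minimalPeriod hp hf hP
  rw [hmn] at hsq ⊢
  have hn : n ≤ (p - 1) * p := by
    rcases h with h | ⟨r, hr, h⟩
    · exact absurd (h.mul_left m) hsq
    · have hr' : r ≤ p - 1 := Nat.le_of_dvd (by omega) hr
      rcases h with rfl | rfl
      · exact hr'.trans (Nat.le_mul_of_pos_right _ (by omega))
      · exact Nat.mul_le_mul_right _ hr'
  calc m * n ≤ (p + 1) * ((p - 1) * p) := Nat.mul_le_mul hm hn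
    _ = (p ^ 2 - 1) * p := by rw [← mul_assoc, ← Nat.sq_sub_sq, one_pow]

theorem minimalPeriod_le_three {f : ProjLine (RatFunc (ZMod 2)) → ProjLine (RatFunc (ZMod 2))}
    {P : ProjLine (RatFunc (ZMod 2))}
    (hf : ∀ v, IsResiduallyDifferentiable (finitePlaceRing 2 v) f)
    (hP : P ∈ Function.periodicPts f) : Function.minimalPeriod f P ≤ 3 := by
  have hfour : ¬4 ∣ Function.minimalPeriod f P := by
    rintro ⟨d, hd⟩
    have hd0 : 0 < d := by
      have := Function.minimalPeriod_pos_of_mem_periodicPts hP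
      omega
    refine minimalPeriod_ne_four (fun v => (hf v).iterate d) (mem_periodicPts_iterate hP d) ?_
    rw [minimalPeriod_iterate_of_dvd hP (Dvd.intro_left _ hd.symm), hd, Nat.mul_div_cancel _ hd0]
  have hsix := minimalPeriod_ne_six hf hP
  obtain ⟨m, n, hm0, hm, hmn, h⟩ := exists_period_eq_mul (hf _) hP
  rw [hmn] at hfour hsix ⊢
  rcases h with h | ⟨r, hr, h⟩
  · exact absurd (h.mul_left m) hfour
  · obtain rfl : r = 1 := by simpa using hr
    rcases h with rfl | rfl <;> interval_cases m <;> omega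

/-- The tail of a preperiodic orbit has at most `p` steps for each point of the cycle. -/
theorem encard_range_iterate_le (hf : ∀ v, IsResiduallyDifferentiable (finitePlaceRing p v) f)
    {N : ℕ} (hN : ∀ Q ∈ Function.periodicPts f, Function.minimalPeriod f Q ≤ N)
    (hP : ∃ Q ∈ Set.range fun n : ℕ => f^[n] P, Q ∈ Function.periodicPts f) :
    (Set.range fun n : ℕ => f^[n] P).encard ≤ (((p + 1) * N : ℕ) : ℕ∞) := by
  classical
  have hex : ∃ T, f^[T] P ∈ Function.periodicPts f := by
    obtain ⟨_, ⟨T, rfl⟩, hT⟩ := hP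
    exact ⟨T, hT⟩
  have hT := Nat.find_spec hex
  have hTmin := fun m => Nat.find_min (m := m) hex
  set T := Nat.find hex
  set n := Function.minimalPeriod f (f^[T] P) with hn
  have hn0 : 0 < n := Function.minimalPeriod_pos_of_mem_periodicPts hT
  have hper : f^[n] (f^[T] P) = f^[T] P := Function.iterate_minimalPeriod
  have hcyc : ∀ m, T ≤ m → f^[n] (f^[m] P) = f^[m] P := by
    intro m hm
    obtain ⟨k, rfl⟩ := Nat.exists_eq_add_of_le' hm
    rw [Function.iterate_add_apply, ← Function.iterate_add_apply, add_comm,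
      Function.iterate_add_apply, hper]
  have hTle : T ≤ p * n := by
    by_contra! hlt
    -- under `f^[n]`, the point `f^[T - (p * n + 1)] P` needs exactly `p + 1` steps to be fixed
    have hmove : ∀ k, (f^[n])^[k] (f^[T - (p * n + 1)] P) = f^[T - (p * n + 1) + k * n] P := by
      intro k
      rw [← Function.iterate_mul, ← Function.iterate_add_apply, add_comm, mul_comm n k]
    have h := isFixedPt_of_isFixedPt_succ (fun v => (hf v).iterate n)
      (S := f^[T - (p * n + 1)] P) (by
        rw [hmove]
        exact hcyc _ (by rw [add_mul]; omega))
    rw [hmove, show T - (p * n + 1) + p * n = T - 1 by omega] at h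
    exact hTmin (T - 1) (by omega) ⟨n, hn0, h⟩
  have hsub : (Set.range fun n : ℕ => f^[n] P) ⊆ (fun m => f^[m] P) '' Set.Iio (T + n) := by
    rintro _ ⟨m, rfl⟩
    rcases lt_or_ge m T with h | h
    · exact ⟨m, by simp only [Set.mem_Iio]; omega, rfl⟩
    · obtain ⟨k, rfl⟩ := Nat.exists_eq_add_of_le' h
      refine ⟨k % n + T, ?_, ?_⟩
      · have := Nat.mod_lt k hn0
        simp only [Set.mem_Iio]
        omega
      · simp only [Function.iterate_add_apply f _ T]
        exact Function.iterate_mod_minimalPeriod_eq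
  calc (Set.range fun n : ℕ => f^[n] P).encard
      ≤ ((fun m => f^[m] P) '' Set.Iio (T + n)).encard := Set.encard_le_encard hsub
    _ ≤ (Set.Iio (T + n)).encard := Set.encard_image_le _ _
    _ = ((T + n : ℕ) : ℕ∞) := by
      rw [← Finset.coe_Iio, Set.encard_coe_eq_coe_finsetCard, Nat.card_Iio]
    _ ≤ (((p + 1) * N : ℕ) : ℕ∞) := by
      have h1 : (p + 1) * n ≤ (p + 1) * N := Nat.mul_le_mul_left _ (hN _ hT)
      rw [add_mul, one_mul] at h1
      exact_mod_cast (by omega : T + n ≤ (p + 1) * N)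

end Bounds

theorem theorem1p3 (p : ℕ) [Fact p.Prime] (φ : ProjLineEndo (RatFunc (ZMod p)))
    (hdeg : 2 ≤ φ.degree)
    (hgood : ∀ v : IsDedekindDomain.HeightOneSpectrum (Polynomial (ZMod p)),
      φ.HasGoodReduction (finitePlaceRing p v))
    (P : ProjLine (RatFunc (ZMod p))) :
    (P ∈ Function.periodicPts φ.onPoints →
      (p = 2 → Function.minimalPeriod φ.onPoints P ≤ 3) ∧
      (p = 3 → Function.minimalPeriod φ.onPoints P ≤ 72) ∧
      (5 ≤ p → Function.minimalPeriod φ.onPoints P ≤ (p ^ 2 - 1) * p)) ∧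
    (φ.IsPreperiodic P →
      (p = 2 → (φ.orbit P).encard ≤ 9) ∧
      (p = 3 → (φ.orbit P).encard ≤ 288) ∧
      (5 ≤ p → (φ.orbit P).encard ≤ (((p + 1) * (p ^ 2 - 1) * p : ℕ) : ℕ∞))) := by
  have hf : ∀ v, IsResiduallyDifferentiable (finitePlaceRing p v) φ.onPoints :=
    fun v => (hgood v).isResiduallyDifferentiable
  refine ⟨fun hP => ⟨?_, ?_, ?_⟩, fun hP => ⟨?_, ?_, ?_⟩⟩
  · rintro rfl
    exact minimalPeriod_le_three hf hP
  · rintro rfl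
    exact (minimalPeriod_le le_rfl hf hP).trans (by norm_num)
  · exact fun hp => minimalPeriod_le (by omega) hf hP
  · rintro rfl
    exact encard_range_iterate_le hf (fun Q hQ => minimalPeriod_le_three hf hQ) hP
  · rintro rfl
    exact (encard_range_iterate_le hf (fun Q hQ => minimalPeriod_le le_rfl hf hQ) hP).trans
      (by norm_num)
  · intro hp
    rw [mul_assoc]
    exact encard_range_iterate_le hf (fun Q hQ => minimalPeriod_le (by omega) hf hQ) hP
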